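/- Let $n \ge 1$. For $t = (t_{i,j,k} \mid 1 \le i<j<k\le n) \in \mathbb{Z}^{\binom n3}$ let \[ G(t) = \langle a_1,\dots,a_n \mid a_j a_i = a_i a_j a_{j+1}^{t_{i,j,j+1}} \cdots a_n^{t_{i,j,n}} \text{ for } 1 \le i<j\le n\rangle , \] and let $\mathcal{C}_n$ be the set of all $t$ for which $G(t)$ is consistent, that is, has Hirsch length exactly $n$ (the Hirsch length of a polycyclic group is the number of infinite factors in a finite subnormal series with cyclic factors). Let $T=(T_{i,j,k})_{1\le i<j<k\le n}$ and $x = (x_1,\dots,x_n)$ be indeterminates. Then: 1. In $G(t)$ the element $a_n$ is central, for every $t\in\mathbb{Z}^{\binom n3}$. For $t\in\mathcal{C}_n$ every element of $G(t)$ can be written uniquely as $a_1^{x_1}\cdots a_n^{x_n}$ with $x\in\mathbb{Z}^n$. Hence for $t \in \mathcal{C}_n$, $x,y\in\mathbb{Z}^n$ and $z\in\mathbb{Z}$ the integers $F_i(t;x,y)$ and $K_i(t;x,z)$, $1 \le i \le n$, are well defined by \[ (a_1^{x_1}\cdots a_n^{x_n})(a_1^{y_1}\cdots a_n^{y_n})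 = a_1^{F_1(t;x,y)}\cdots a_n^{F_n(t;x,y)}, \qquad (a_1^{x_1}\cdots a_n^{x_n})^z = a_1^{K_1(t;x,z)}\cdots a_n^{K_n(t;x,z)}. \] 2. There is a polynomial $H_n$ with rational coefficients in the indeterminates $T$, $x_1,\dots,x_{n-1}$, $y_1,\dots,y_{n-1}$ such that for all $t\in\mathcal{C}_n$ and $x,y\in\mathbb{Z}^n$ \[ F_n(t;x,y) = x_n+y_n+H_n(t;x_1,\dots,x_{n-1},y_1,\dots,y_{n-1}). \] 3. There is a polynomial $h = h(T;x,z) = c_0 + c_1 z + \dots + c_l z^l\in\mathbb{Q}[T,x][z]$ such that for all $t\in\mathcal{C}_n$, $x\in\mathbb{Z}^n$ and $z\in\mathbb{Z}$ \[ K_n(t;x,z+1) = K_n(t;x,z)+h(t;x,z). \] Moreover, let $B_k$ be the Bernoulli numbers with $B_1=-\tfrac12$ and put \[ P(z) = \sum_{m=1}^{l+1} f_m z^m \in \mathbb{Q}[T,x][z], \qquad f_m = \sum_{k=0}^{l+1-m}\frac{c_{m+k-1}}{m+k}\,B_k\binom{m+k}{k}. \] Then $P(0)=0$ and $P(z+1)=P(z)+h(z)$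 in $\mathbb{Q}[T,x][z]$, and $P$ is a powering polynomial: $K_n(t;x,z) = P(t;x,z)$ for all $t\in\mathcal{C}_n$, $x\in\mathbb{Z}^n$ and $z\in\mathbb{Z}$. -/

import Mathlib

open Polynomial

noncomputable section

namespace HallPoly

/-- The ordered product `g_1 ^ x_1 * ... * g_n ^ x_n` in a group. -/
def orderedProd {n : ℕ} {G : Type*} [Group G] (g : Fin n → G) (x : Fin n → ℤ) : G :=
  (List.ofFn fun i => g i ^ x i).prod

/-- The index set of the parameters: the triples `(i, j, k)` with `i < j < k`. -/
abbrev Triple (n : ℕ) : Type :=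
  {p : Fin n × Fin n × Fin n // p.1 < p.2.1 ∧ p.2.1 < p.2.2}

/-- The exponents of the tail `a_{j+1} ^ t_{i,j,j+1} * ... * a_n ^ t_{i,j,n}`
(the exponent of `a_k` is `0` for `k ≤ j`). -/
def tailExp {n : ℕ} (t : Triple n → ℤ) (i j k : Fin n) : ℤ :=
  if hk : i < j ∧ j < k then t ⟨(i, j, k), hk⟩ else 0

/-- The relators `(a_i a_j a_{j+1} ^ t_{i,j,j+1} ... a_n ^ t_{i,j,n})⁻¹ a_j a_i`, `i < j`. -/
def relators {n : ℕ} (t : Triple n → ℤ) : Set (FreeGroup (Fin n)) :=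
  {r | ∃ i j : Fin n, i < j ∧
    r = (FreeGroup.of i * FreeGroup.of j * orderedProd FreeGroup.of (tailExp t i j))⁻¹ *
      (FreeGroup.of j * FreeGroup.of i)}

/-- The group `G(t)` given by the nilpotent presentation with parameters `t`. -/
abbrev NilGroup {n : ℕ} (t : Triple n → ℤ) : Type := PresentedGroup (relators t)

/-- The generator `a_i` of `G(t)`. -/
def gen {n : ℕ} (t : Triple n → ℤ) (i : Fin n) : NilGroup t := PresentedGroup.of i

/-- The element `a_1 ^ x_1 * ... * a_n ^ x_n` of `G(t)`. -/
def normalWord {n : ℕ} (t : Triple n → ℤ) (x : Fin n → ℤ) : NilGroup t :=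
  orderedProd (gen t) x

/-- `SeriesLength H h`: the subgroup `H` has a finite subnormal series with cyclic factors
which ends in the trivial group and has exactly `h` infinite factors. -/
inductive SeriesLength {G : Type*} [Group G] : Subgroup G → ℕ → Prop
  | bot : SeriesLength ⊥ 0
  | finite_step (N H : Subgroup G) (h : ℕ) (hN : SeriesLength N h) (hle : N ≤ H)
      [(N.subgroupOf H).Normal] (hcyc : IsCyclic (H ⧸ N.subgroupOf H))
      (hfin : Finite (H ⧸ N.subgroupOf H)) : SeriesLength H h
  | infinite_step (N H : Subgroup G) (h : ℕ) (hN : SeriesLength N h) (hle : N ≤ H)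
      [(N.subgroupOf H).Normal] (hcyc : IsCyclic (H ⧸ N.subgroupOf H))
      (hinf : Infinite (H ⧸ N.subgroupOf H)) : SeriesLength H (h + 1)

/-- The group `G` is polycyclic of Hirsch length `h`: it has a finite subnormal series with
cyclic factors, exactly `h` of which are infinite. -/
def HasHirschLength (G : Type*) [Group G] (h : ℕ) : Prop := SeriesLength (⊤ : Subgroup G) h

/-- The set `C_n` of all parameters `t` for which `G(t)` is consistent, that is, has Hirsch
length precisely `n`. -/
def consistentParams (n : ℕ) : Set (Triple n → ℤ) := {t | HasHirschLength (NilGroup t) n}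

/-- The exponent vector of an element of `G(t)`: a vector `x` with
`g = a_1 ^ x_1 * ... * a_n ^ x_n` (it is unique if `t` is consistent). -/
def exponents {n : ℕ} (t : Triple n → ℤ) (g : NilGroup t) : Fin n → ℤ :=
  Function.invFun (normalWord t) g

/-- The multiplication functions: `multFun t x y i` is `F_i(t; x, y)`. -/
def multFun {n : ℕ} (t : Triple n → ℤ) (x y : Fin n → ℤ) : Fin n → ℤ :=
  exponents t (normalWord t x * normalWord t y)

/-- The powering functions: `powFun t x z i` is `K_i(t; x, z)`. -/
def powFun {n : ℕ} (t : Triple n → ℤ) (x : Fin n → ℤ) (z : ℤ) : Fin n → ℤ :=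
  exponents t (normalWord t x ^ z)

/-- The ring `ℚ[T, x]`. -/
abbrev ParamRing (n : ℕ) : Type := MvPolynomial (Triple n ⊕ Fin n) ℚ

/-- The value at integers `(t, x, z)` of a polynomial in `ℚ[T, x][z]`. -/
def evalAt {n : ℕ} (t : Triple n → ℤ) (x : Fin n → ℤ) (z : ℤ) (p : (ParamRing n)[X]) : ℚ :=
  MvPolynomial.eval (Sum.elim (fun a => (t a : ℚ)) (fun i => (x i : ℚ)))
    (p.eval (z : ParamRing n))

/-- For `g = c_0 + c_1 X + ... + c_l X ^ l`, the polynomial `f_0 + f_1 X + ... + f_{l+1} X ^ (l+1)`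
with `f_m = ∑_{k=0}^{l+1-m} c_{m+k-1} / (m+k) * B_k * binom (m+k) k` for `m > 0`, where the
`B_k` are the Bernoulli numbers with `B_1 = -1/2`. -/
def bernoulliSolution {R : Type*} [CommRing R] [Algebra ℚ R] (g : R[X]) (f₀ : R) : R[X] :=
  C f₀ + ∑ m ∈ Finset.Icc 1 (g.natDegree + 1),
    C (∑ k ∈ Finset.range (g.natDegree + 2 - m),
      (_root_.bernoulli k * ((m + k).choose k : ℚ) / ((m + k : ℕ) : ℚ)) • g.coeff (m + k - 1)) * X ^ m

end HallPoly

end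

/-! Write `U_i = upper t i` for the subgroup generated by the last generators. Modulo `U_{k+1}`
every tail that involves `a_k` disappears, so `a_k` is central there (`commute_mk_gen`). The `U_i`
therefore form a central series with cyclic factors, every element has a normal form, and the last
generator is central. Uniqueness comes from Hirsch length `n`: an infinite factor in a series of
subgroups must create a new leading index (`SeriesLength.le_ncard`), so all `n` generators have
infinite order modulo the next `U`.

Polynomiality is proved by descending induction on `i` (`polynomialMul`): multiplication in `U_i`
preserves families of elements whose exponents lie in an algebra `A` of functions containing the
parameters. Since `A` and its domain are arbitrary, an integer variable `z` can be adjoined by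
passing to `polyExt A`. Centrality makes the `k`-th exponent of a power, or of a conjugate by `a_i ^
z`, change with `z` by an amount that depends only on earlier exponents. Bernoulli summation then
turns polynomial differences into polynomial functions. Taking `A` to be the functions given by
polynomials yields `H_n` and a polynomial for `K_n`. The difference of the latter is `h`, and
summing `h` recovers `K_n` because a function on `ℤ` is determined by its differences and its value
at `0`. -/

namespace HallPoly

/-! ### Summation by Bernoulli polynomials -/

section Summation

variable {R : Type*} [CommRing R] [Algebra ℚ R]

/-- The combination of Bernoulli polynomials which solves `P (X + 1) - P X = g`. -/
noncomputable def bernoulliCombination (g : R[X]) : R[X] :=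
  ∑ j ∈ Finset.range (g.natDegree + 1),
    C (((j + 1 : ℕ) : ℚ)⁻¹ • g.coeff j) * (Polynomial.bernoulli (j + 1)).map (algebraMap ℚ R)

/-- Term by term this is `B_{j+1}(X + 1) - B_{j+1}(X) = (j + 1) X ^ j`. -/
theorem bernoulliCombination_comp (g : R[X]) :
    (bernoulliCombination g).comp (X + 1) = bernoulliCombination g + g := by
  conv_rhs => enter [2]; rw [g.as_sum_range_C_mul_X_pow]
  rw [bernoulliCombination, Polynomial.sum_comp, ← Finset.sum_add_distrib]
  refine Finset.sum_congr rfl fun j _ => ?_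
  have h : ((Polynomial.bernoulli (j + 1)).map (algebraMap ℚ R)).comp (X + 1) =
      (Polynomial.bernoulli (j + 1)).map (algebraMap ℚ R) + (j + 1 : ℕ) • X ^ j := by
    have := congrArg (Polynomial.map (algebraMap ℚ R)) (bernoulli_comp_one_add_X (j + 1))
    rw [Polynomial.map_comp] at this
    simpa [add_comm] using this
  rw [mul_comp, C_comp, h, mul_add, mul_smul_comm, ← smul_mul_assoc, ← Polynomial.smul_C,
    ← Nat.cast_smul_eq_nsmul ℚ, smul_smul,
    mul_inv_cancel₀ (Nat.cast_ne_zero.2 j.succ_ne_zero), one_smul]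

/-- The explicit coefficients `f_m` are those of the Bernoulli combination in positive degree, so
only the constant term needs correcting; constants do not affect differences. -/
theorem bernoulliSolution_eq_add_C (g : R[X]) (f₀ : R) :
    bernoulliSolution g f₀ =
      bernoulliCombination g + C (f₀ - (bernoulliCombination g).coeff 0) := by
  ext M
  rcases M with _ | M
  · simp only [bernoulliSolution, coeff_add, coeff_C_zero, finsetSum_coeff, coeff_C_mul,
      coeff_X_pow]
    rw [Finset.sum_eq_zero]
    · ring
    · intro m hm
      rw [if_neg (by rw [Finset.mem_Icc] at hm; omega), mul_zero]
  · simp only [bernoulliSolution, coeff_add, coeff_C_succ, finsetSum_coeff, coeff_C_mul,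
      coeff_X_pow, bernoulliCombination, coeff_map, Polynomial.coeff_bernoulli]
    simp only [mul_ite, mul_one, mul_zero, zero_add, add_zero, Finset.sum_ite_eq,
      Finset.mem_Icc]
    split_ifs with hM
    -- Only the summands `j = M + k` reach degree `M + 1`; `d` is the number of admissible `k`.
    · obtain ⟨d, hd⟩ : ∃ d, g.natDegree + 1 = M + d := ⟨g.natDegree + 1 - M, by omega⟩
      rw [hd, Finset.sum_range_add, show g.natDegree + 2 - (M + 1) = d by omega,
        Finset.sum_eq_zero (s := Finset.range M), zero_add]
      · refine Finset.sum_congr rfl fun k _ => ?_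
        rw [if_pos (by omega), show M + k + 1 - (M + 1) = k by omega,
          show M + 1 + k - 1 = M + k by omega, show M + 1 + k = M + k + 1 by omega,
          mul_comm (_ • g.coeff _), ← Algebra.smul_def, smul_smul, div_eq_mul_inv,
          ← Nat.choose_symm (show k ≤ M + k + 1 by omega),
          show M + k + 1 - k = M + 1 by omega]
      · intro j hj
        rw [Finset.mem_range] at hj
        rw [if_neg (by omega), map_zero, mul_zero]
    · rw [Finset.sum_eq_zero]
      intro j hj
      rw [Finset.mem_range] at hj
      rw [if_neg (by omega), map_zero, mul_zero]

theorem bernoulliSolution_comp (g : R[X]) (f₀ : R) :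
    (bernoulliSolution g f₀).comp (X + 1) = bernoulliSolution g f₀ + g := by
  rw [bernoulliSolution_eq_add_C, add_comp, C_comp, bernoulliCombination_comp]
  ring

theorem bernoulliSolution_eval_zero (g : R[X]) (f₀ : R) :
    (bernoulliSolution g f₀).eval 0 = f₀ := by
  rw [bernoulliSolution_eq_add_C, eval_add, eval_C, ← coeff_zero_eq_eval_zero]
  ring

theorem bernoulliSolution_eval_add_one (g : R[X]) (f₀ z : R) :
    (bernoulliSolution g f₀).eval (z + 1) = (bernoulliSolution g f₀).eval z + g.eval z := by
  have := congrArg (Polynomial.eval z) (bernoulliSolution_comp g f₀)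
  simpa [eval_comp] using this

/-- Two functions on the integers with the same value at `0` and the same differences agree. -/
theorem eq_of_forall_add_one {M : Type*} [AddGroup M] {f g d : ℤ → M} (h0 : f 0 = g 0)
    (hf : ∀ z, f (z + 1) = f z + d z) (hg : ∀ z, g (z + 1) = g z + d z) (z : ℤ) : f z = g z := by
  induction z using Int.induction_on with
  | zero => exact h0
  | succ i ih => rw [hf, hg, ih]
  | pred i ih =>
    have h1 := hf (-(i : ℤ) - 1)
    have h2 := hg (-(i : ℤ) - 1)
    rw [sub_add_cancel] at h1 h2
    exact add_right_cancel (h1.symm.trans (ih.trans h2))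

end Summation

/-! ### Adjoining an integer variable to an algebra of functions -/

section PolyExt

variable {D : Type*}

/-- The functions on `D × ℤ` which are polynomials in the second argument with coefficients
in a given algebra of functions on `D`. -/
def polyExt (A : Subalgebra ℚ (D → ℚ)) : Subalgebra ℚ (D × ℤ → ℚ) where
  carrier := {f | ∃ p : A[X], ∀ d z, f (d, z) = (p.eval (z : A) : A).1 d}
  mul_mem' := by
    rintro f g ⟨p, hp⟩ ⟨q, hq⟩
    exact ⟨p * q, fun d z => by simp [hp, hq]⟩
  add_mem' := by
    rintro f g ⟨p, hp⟩ ⟨q, hq⟩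
    exact ⟨p + q, fun d z => by simp [hp, hq]⟩
  algebraMap_mem' r := ⟨C (algebraMap ℚ A r), fun d z => by rw [eval_C]; rfl⟩

variable {A : Subalgebra ℚ (D → ℚ)}

theorem comp_fst_mem_polyExt {f : D → ℚ} (hf : f ∈ A) : (fun p : D × ℤ => f p.1) ∈ polyExt A :=
  ⟨C ⟨f, hf⟩, fun d z => by simp⟩

/-- Evaluation at `d` is a ring homomorphism on `A`, so at the point `d` it makes no difference
whether the coefficient polynomial is evaluated at the function `z` or at the constant `z d`. -/
theorem comp_graph_mem {f : D × ℤ → ℚ} (hf : f ∈ polyExt A) {z : D → ℤ}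
    (hz : (fun d => (z d : ℚ)) ∈ A) : (fun d => f (d, z d)) ∈ A := by
  obtain ⟨p, hp⟩ := hf
  have : (fun d => f (d, z d)) = (p.eval (⟨fun d => (z d : ℚ), hz⟩ : A) : A).1 := by
    funext d
    have key : ∀ w : A, (p.eval w : A).1 d =
        p.eval₂ ((Pi.evalRingHom (fun _ : D => ℚ) d).comp A.val.toRingHom) (w.1 d) := by
      intro w
      exact (Polynomial.eval₂_hom (p := p)
        ((Pi.evalRingHom (fun _ : D => ℚ) d).comp A.val.toRingHom) w).symm
    rw [hp, key, key]
    simp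
  rw [this]
  exact Subtype.property _

/-- A function whose differences in `z` are polynomial in `z` is polynomial in `z`. -/
theorem mem_polyExt_of_sub_mem {S : D × ℤ → ℚ} (h0 : (fun d => S (d, 0)) ∈ A)
    (hS : (fun p : D × ℤ => S (p.1, p.2 + 1) - S p) ∈ polyExt A) : S ∈ polyExt A := by
  obtain ⟨p, hp⟩ := hS
  refine ⟨bernoulliSolution p ⟨_, h0⟩, fun d => ?_⟩
  refine eq_of_forall_add_one (d := fun z => (p.eval (z : A) : A).1 d) ?_ ?_ ?_
  · simp [bernoulliSolution_eval_zero]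
  · intro z
    rw [← hp]
    simp
  · intro z
    rw [Int.cast_add, Int.cast_one, bernoulliSolution_eval_add_one]
    rfl

end PolyExt

end HallPoly

/-! ### Ordered products -/

namespace HallPoly

section OrderedProd

variable {n : ℕ} {G : Type*} [Group G]

theorem orderedProd_succ (g : Fin (n + 1) → G) (x : Fin (n + 1) → ℤ) :
    orderedProd g x = g 0 ^ x 0 * orderedProd (fun i => g i.succ) (fun i => x i.succ) := by
  simp [orderedProd, List.ofFn_succ]

theorem orderedProd_zero (g : Fin n → G) : orderedProd g 0 = 1 := by
  induction n with
  | zero => simp [orderedProd]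
  | succ n ih =>
    rw [orderedProd_succ, Pi.zero_apply, zpow_zero, one_mul]
    exact ih fun i => g i.succ

theorem orderedProd_add (g : Fin n → G) {x y : Fin n → ℤ} (i : ℕ)
    (hx : ∀ k : Fin n, i ≤ k → x k = 0) (hy : ∀ k : Fin n, (k : ℕ) < i → y k = 0) :
    orderedProd g (x + y) = orderedProd g x * orderedProd g y := by
  induction n generalizing i with
  | zero => simp [orderedProd]
  | succ n ih =>
    cases i with
    | zero =>
      obtain rfl : x = 0 := funext fun k => hx k (Nat.zero_le _)
      rw [zero_add, orderedProd_zero, one_mul]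
    | succ i =>
      have h := ih (fun i => g i.succ) (x := fun k => x k.succ) (y := fun k => y k.succ) i
        (fun k hk => hx _ (by simpa using hk)) (fun k hk => hy _ (by simpa using hk))
      rw [orderedProd_succ, orderedProd_succ g x, orderedProd_succ g y,
        hy 0 (Nat.succ_pos i), zpow_zero, one_mul, mul_assoc, ← h, Pi.add_apply,
        hy 0 (Nat.succ_pos i), add_zero]
      rfl

theorem orderedProd_single (g : Fin n → G) (k : Fin n) (c : ℤ) :
    orderedProd g (Pi.single k c) = g k ^ c := by
  induction n with
  | zero => exact k.elim0
  | succ n ih =>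
    rw [orderedProd_succ]
    cases k using Fin.cases with
    | zero =>
      have : (fun i : Fin n => (Pi.single 0 c : Fin (n + 1) → ℤ) i.succ) = 0 := by
        funext i
        simp
      rw [this, orderedProd_zero, Pi.single_eq_same, mul_one]
    | succ k =>
      have : (fun i : Fin n => (Pi.single k.succ c : Fin (n + 1) → ℤ) i.succ) =
          Pi.single k c := by
        funext i
        simp [Pi.single_apply]
      rw [this, ih, Pi.single_eq_of_ne (Fin.succ_ne_zero k).symm, zpow_zero, one_mul]

theorem orderedProd_mem (g : Fin n → G) (x : Fin n → ℤ) (H : Subgroup G)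
    (h : ∀ k, x k ≠ 0 → g k ∈ H) : orderedProd g x ∈ H := by
  refine H.list_prod_mem fun a ha => ?_
  obtain ⟨k, rfl⟩ := (List.mem_ofFn' _ _).1 ha
  by_cases hk : x k = 0
  · simp [hk]
  · exact H.zpow_mem (h k hk) _

theorem map_orderedProd {G' : Type*} [Group G'] (f : G →* G') (g : Fin n → G) (x : Fin n → ℤ) :
    f (orderedProd g x) = orderedProd (fun i => f (g i)) x := by
  simp only [orderedProd, map_list_prod, List.map_ofFn]
  congr 2
  funext i
  simp

end OrderedProd

/-! ### The central series and existence of normal forms -/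

variable {n : ℕ} (t : Triple n → ℤ)

theorem gen_mul_gen {i j : Fin n} (hij : i < j) :
    gen t j * gen t i = gen t i * gen t j * normalWord t (tailExp t i j) := by
  have h : PresentedGroup.mk (relators t) ((FreeGroup.of i * FreeGroup.of j *
      orderedProd FreeGroup.of (tailExp t i j))⁻¹ * (FreeGroup.of j * FreeGroup.of i)) = 1 :=
    PresentedGroup.one_of_mem ⟨i, j, hij, rfl⟩
  rw [map_mul, map_inv, inv_mul_eq_one] at h
  simp only [map_mul, map_orderedProd] at h
  exact h.symm

/-- The subgroup of `G(t)` generated by the `a_j` with `i ≤ j`. -/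
def upper (i : ℕ) : Subgroup (NilGroup t) := Subgroup.closure (gen t '' {j | i ≤ (j : ℕ)})

variable {t}

theorem gen_mem_upper {i : ℕ} {j : Fin n} (h : i ≤ j) : gen t j ∈ upper t i :=
  Subgroup.subset_closure ⟨j, h, rfl⟩

theorem upper_le_iff {i : ℕ} {H : Subgroup (NilGroup t)} :
    upper t i ≤ H ↔ ∀ j : Fin n, i ≤ j → gen t j ∈ H := by
  rw [upper, Subgroup.closure_le]
  exact Set.forall_mem_image

theorem upper_anti {i j : ℕ} (h : i ≤ j) : upper t j ≤ upper t i :=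
  upper_le_iff.2 fun _ hk => gen_mem_upper (h.trans hk)

theorem upper_eq_bot {i : ℕ} (h : n ≤ i) : upper t i = ⊥ :=
  le_bot_iff.1 <| upper_le_iff.2 fun j hj => absurd j.2 (by omega)

theorem upper_zero : upper t 0 = ⊤ := by
  rw [eq_top_iff, ← PresentedGroup.closure_range_of, Subgroup.closure_le]
  rintro _ ⟨j, rfl⟩
  exact gen_mem_upper (Nat.zero_le _)

theorem normalWord_mem_upper {i : ℕ} {x : Fin n → ℤ} (h : ∀ k : Fin n, (k : ℕ) < i → x k = 0) :
    normalWord t x ∈ upper t i :=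
  orderedProd_mem _ _ _ fun k hk => gen_mem_upper (not_lt.1 fun hlt => hk (h k hlt))

theorem tailExp_eq_zero {i j k : Fin n} (h : (k : ℕ) < j + 1) : tailExp t i j k = 0 :=
  dif_neg fun hk => absurd (Fin.lt_def.1 hk.2) (by omega)

/-- A relation whose larger index is at least `k` has its tail in `upper t (k + 1)`, so the image of
`a_k` commutes with all generators. Normality is a hypothesis because `upper_normal` uses this lemma
in its own descending induction. -/
theorem commute_mk_gen (k : Fin n) [(upper t (k + 1)).Normal] (g : NilGroup t) :
    Commute (g : NilGroup t ⧸ upper t (k + 1)) (gen t k : NilGroup t ⧸ upper t (k + 1)) := by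
  have key : ∀ i j : Fin n, i < j → (k : ℕ) ≤ j →
      (gen t j * gen t i : NilGroup t ⧸ upper t (k + 1)) = gen t i * gen t j := by
    intro i j hij hk
    rw [← QuotientGroup.mk_mul, ← QuotientGroup.mk_mul, gen_mul_gen t hij]
    refine (QuotientGroup.eq.2 ?_).symm
    rw [inv_mul_cancel_left]
    exact normalWord_mem_upper fun l hl => tailExp_eq_zero (by omega)
  have : upper t 0 ≤ (Subgroup.centralizer {(gen t k : NilGroup t ⧸ upper t (k + 1))}).comap
      (QuotientGroup.mk' _) := by
    refine upper_le_iff.2 fun j _ => ?_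
    rw [Subgroup.mem_comap, Subgroup.mem_centralizer_singleton_iff]
    rcases lt_trichotomy j k with h | rfl | h
    · exact (key j k h le_rfl).symm
    · rfl
    · exact key k j h (Fin.lt_def.1 h).le
  have hg := this (upper_zero (t := t) ▸ Subgroup.mem_top g)
  rw [Subgroup.mem_comap, Subgroup.mem_centralizer_singleton_iff] at hg
  exact hg

theorem exists_of_mem_upper (k : Fin n) [(upper t (k + 1)).Normal] {g : NilGroup t}
    (hg : g ∈ upper t k) : ∃ c : ℤ, ∃ u ∈ upper t (k + 1), g = gen t k ^ c * u := by
  have h : upper t k ≤ Subgroup.zpowers (gen t k) ⊔ upper t (k + 1) := by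
    refine upper_le_iff.2 fun j hj => ?_
    rcases hj.eq_or_lt with h | h
    · rw [← Fin.ext h]
      exact Subgroup.mem_sup_left (Subgroup.mem_zpowers _)
    · exact Subgroup.mem_sup_right (gen_mem_upper h)
  obtain ⟨y, ⟨c, rfl⟩, u, hu, rfl⟩ := Subgroup.mem_sup_of_normal_right.1 (h hg)
  exact ⟨c, u, hu, rfl⟩

instance upper_normal (i : ℕ) : (upper t i).Normal := by
  by_cases h : n ≤ i
  · rw [upper_eq_bot h]
    infer_instance
  · obtain ⟨d, hd⟩ : ∃ d, n = i + d := ⟨n - i, by omega⟩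
    induction d generalizing i with
    | zero => omega
    | succ d ih =>
      have hN : (upper t (i + 1)).Normal := by
        by_cases h' : n ≤ i + 1
        · rw [upper_eq_bot h']
          infer_instance
        · exact ih (i + 1) h' (by omega)
      obtain ⟨k, rfl⟩ : ∃ k : Fin n, i = k := ⟨⟨i, not_le.1 h⟩, rfl⟩
      refine ⟨fun a ha g => ?_⟩
      obtain ⟨c, u, hu, rfl⟩ := exists_of_mem_upper k ha
      -- By centrality, conjugation fixes `a_k ^ c` modulo the next term, which is already known to
      -- be normal.
      have h1 : ((gen t k ^ c)⁻¹ * (g * (gen t k ^ c * u) * g⁻¹)) ∈ upper t (k + 1) := by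
        rw [← QuotientGroup.eq]
        have hu' : (u : NilGroup t ⧸ upper t (k + 1)) = 1 := (QuotientGroup.eq_one_iff u).2 hu
        simp only [QuotientGroup.mk_mul, QuotientGroup.mk_zpow, QuotientGroup.mk_inv, hu',
          mul_one]
        rw [((commute_mk_gen k g).zpow_right c).eq, mul_inv_cancel_right]
      have h2 := (upper t k).mul_mem ((upper t k).zpow_mem (gen_mem_upper le_rfl) c)
        (upper_anti (Nat.le_succ _) h1)
      rwa [mul_inv_cancel_left] at h2

theorem gen_last_mem_center {m : ℕ} (t : Triple (m + 1) → ℤ) :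
    gen t (Fin.last m) ∈ Subgroup.center (NilGroup t) := by
  rw [Subgroup.mem_center_iff]
  intro g
  have h := commute_mk_gen (t := t) (Fin.last m) g
  rw [commute_iff_eq, ← QuotientGroup.mk_mul, ← QuotientGroup.mk_mul, QuotientGroup.eq,
    upper_eq_bot (by simp), Subgroup.mem_bot, inv_mul_eq_one] at h
  exact h

theorem exists_normalWord_of_mem_upper {i : ℕ} {g : NilGroup t} (hg : g ∈ upper t i) :
    ∃ x : Fin n → ℤ, (∀ k : Fin n, (k : ℕ) < i → x k = 0) ∧ normalWord t x = g := by
  by_cases h : n ≤ i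
  · rw [upper_eq_bot h, Subgroup.mem_bot] at hg
    exact ⟨0, fun _ _ => rfl, by rw [hg]; exact orderedProd_zero _⟩
  · obtain ⟨d, hd⟩ : ∃ d, n = i + d := ⟨n - i, by omega⟩
    induction d generalizing i g with
    | zero => omega
    | succ d ih =>
      obtain ⟨k, rfl⟩ : ∃ k : Fin n, i = k := ⟨⟨i, not_le.1 h⟩, rfl⟩
      obtain ⟨c, u, hu, rfl⟩ := exists_of_mem_upper k hg
      obtain ⟨x, hx, rfl⟩ : ∃ x : Fin n → ℤ, (∀ l : Fin n, (l : ℕ) < k + 1 → x l = 0) ∧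
          normalWord t x = u := by
        by_cases h' : n ≤ k + 1
        · rw [upper_eq_bot h', Subgroup.mem_bot] at hu
          exact ⟨0, fun _ _ => rfl, by rw [hu]; exact orderedProd_zero _⟩
        · exact ih hu h' (by omega)
      refine ⟨Pi.single k c + x, fun l hl => ?_, ?_⟩
      · rw [Pi.add_apply, hx l (by omega), Pi.single_eq_of_ne (by rintro rfl; omega), add_zero]
      · rw [normalWord, orderedProd_add _ (k + 1) _ hx, orderedProd_single]
        · rfl
        · intro l hl
          exact Pi.single_eq_of_ne (by rintro rfl; omega) _

theorem normalWord_surjective (t : Triple n → ℤ) : Function.Surjective (normalWord t) := by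
  intro g
  obtain ⟨x, -, hx⟩ := exists_normalWord_of_mem_upper (t := t) (i := 0) (g := g)
    (upper_zero (t := t) ▸ Subgroup.mem_top g)
  exact ⟨x, hx⟩

end HallPoly

/-! ### Hirsch length and leading indices -/

namespace HallPoly

section Hirsch

variable {n : ℕ} {t : Triple n → ℤ}

theorem finite_quotient_of_cover {G : Type*} [Group G] {N H : Subgroup G} {F : Set G}
    (hF : F.Finite) (h : ∀ g ∈ H, ∃ f ∈ F, f⁻¹ * g ∈ N) : Finite (H ⧸ N.subgroupOf H) := by
  choose! f hfF hf using h
  have : Finite F := hF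
  refine Finite.of_injective
    (fun q : H ⧸ N.subgroupOf H => (⟨f (q.out : H), hfF _ (q.out : H).2⟩ : F)) fun q r hqr => ?_
  have hqr' : f (q.out : H) = f (r.out : H) := congrArg Subtype.val hqr
  rw [← QuotientGroup.out_eq' q, ← QuotientGroup.out_eq' r, QuotientGroup.eq,
    Subgroup.mem_subgroupOf]
  have := N.mul_mem (N.inv_mem (hf _ (q.out : H).2)) (hf _ (r.out : H).2)
  rw [hqr'] at this
  simpa using this

variable (t) in
/-- The indices `i` for which `a_i` has infinite order modulo `⟨a_{i+1}, ..., a_n⟩` and some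
element of `K` has leading factor `a_i ^ c`, `c ≠ 0`. -/
def leadingIndices (K : Subgroup (NilGroup t)) : Set (Fin n) :=
  {i | (∀ c : ℤ, gen t i ^ c ∈ upper t (i + 1) → c = 0) ∧
    ∃ c : ℤ, c ≠ 0 ∧ ∃ u ∈ upper t (i + 1), gen t i ^ c * u ∈ K}

theorem leadingIndices_mono {N H : Subgroup (NilGroup t)} (h : N ≤ H) :
    leadingIndices t N ⊆ leadingIndices t H :=
  fun _ ⟨h1, c, hc, u, hu, hN⟩ => ⟨h1, c, hc, u, hu, h hN⟩

/-- If `N` has every leading index of `H`, then `N` has finite index in `H`. The cover is built by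
descending induction on `i`, one leading exponent at a time. -/
theorem exists_cover {N H : Subgroup (NilGroup t)} (hle : N ≤ H)
    (h : leadingIndices t H ⊆ leadingIndices t N) (i : ℕ) :
    ∃ F : Set (NilGroup t), F.Finite ∧ ∀ g ∈ H, g ∈ upper t i → ∃ f ∈ F, f⁻¹ * g ∈ N := by
  by_cases hi : n ≤ i
  · refine ⟨{1}, Set.finite_singleton 1, fun g _ hg => ⟨1, rfl, ?_⟩⟩
    rw [upper_eq_bot hi, Subgroup.mem_bot] at hg
    simp [hg]
  obtain ⟨d, hd⟩ : ∃ d, n = i + d := ⟨n - i, by omega⟩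
  induction d generalizing i with
  | zero => omega
  | succ d ih =>
    obtain ⟨F, hF, hcov⟩ : ∃ F : Set (NilGroup t), F.Finite ∧
        ∀ g ∈ H, g ∈ upper t (i + 1) → ∃ f ∈ F, f⁻¹ * g ∈ N := by
      by_cases hi' : n ≤ i + 1
      · refine ⟨{1}, Set.finite_singleton 1, fun g _ hg => ⟨1, rfl, ?_⟩⟩
        rw [upper_eq_bot hi', Subgroup.mem_bot] at hg
        simp [hg]
      · exact ih (i + 1) hi' (by omega)
    obtain ⟨k, rfl⟩ : ∃ k : Fin n, i = k := ⟨⟨i, not_le.1 hi⟩, rfl⟩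
    have main : ∀ c : ℤ, c ≠ 0 → ∀ u ∈ upper t (k + 1), gen t k ^ c * u ∈ N →
        ∃ F : Set (NilGroup t), F.Finite ∧ ∀ g ∈ H, g ∈ upper t k → ∃ f ∈ F, f⁻¹ * g ∈ N := by
      intro c hc u hu huN
      classical
      -- Residue representatives are chosen in `H`, rather than as powers of `a_k`, so that after
      -- division the remainder stays in `H` and the cover `F` applies. The default `1` plays no
      -- role.
      let b : ℤ → NilGroup t := fun r =>
        if h : ∃ b ∈ H, (gen t k ^ r)⁻¹ * b ∈ upper t (k + 1) then h.choose else 1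
      refine ⟨Set.image2 (fun r f => b r * f) (Set.Ico 0 |c|) F,
        (Set.finite_Ico _ _).image2 _ hF, fun g hg hgk => ?_⟩
      obtain ⟨e, v, hv, rfl⟩ := exists_of_mem_upper k hgk
      set w := gen t k ^ c * u with hw
      set g := gen t k ^ e * v with hgdef
      -- Division with remainder of the leading exponent `e` by `c`, carried out with powers of `w ∈
      -- N`.
      have hmk : ((gen t k ^ (e % c))⁻¹ * (g * (w ^ (e / c))⁻¹)) ∈ upper t (k + 1) := by
        have hu' : (u : NilGroup t ⧸ upper t (k + 1)) = 1 := (QuotientGroup.eq_one_iff u).2 hu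
        have hv' : (v : NilGroup t ⧸ upper t (k + 1)) = 1 := (QuotientGroup.eq_one_iff v).2 hv
        rw [← QuotientGroup.eq, hw, hgdef]
        simp only [QuotientGroup.mk_mul, QuotientGroup.mk_zpow, QuotientGroup.mk_inv, hu', hv',
          mul_one]
        rw [← zpow_mul, ← zpow_neg, ← zpow_add]
        congr 1
        have := Int.emod_add_mul_ediv e c
        linarith
      have hwH : w ^ (e / c) ∈ N := N.zpow_mem huN _
      have hex : ∃ b ∈ H, (gen t k ^ (e % c))⁻¹ * b ∈ upper t (k + 1) :=
        ⟨_, H.mul_mem hg (H.inv_mem (hle hwH)), hmk⟩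
      have hb : b (e % c) = hex.choose := dif_pos hex
      obtain ⟨hbH, hbU⟩ := hex.choose_spec
      rw [← hb] at hbH hbU
      obtain ⟨f, hf, hfN⟩ := hcov ((b (e % c))⁻¹ * (g * (w ^ (e / c))⁻¹))
        (H.mul_mem (H.inv_mem hbH) (H.mul_mem hg (H.inv_mem (hle hwH)))) (by
          have := (upper t (k + 1)).mul_mem ((upper t (k + 1)).inv_mem hbU) hmk
          rwa [mul_inv_rev, inv_inv, mul_assoc, mul_inv_cancel_left] at this)
      refine ⟨_, ⟨e % c, ⟨Int.emod_nonneg _ hc, Int.emod_lt_abs _ hc⟩, f, hf, rfl⟩, ?_⟩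
      have := N.mul_mem hfN hwH
      simpa [mul_assoc] using this
    by_cases hk : k ∈ leadingIndices t H
    · obtain ⟨-, c, hc, u, hu, huN⟩ := h hk
      exact main c hc u hu huN
    · by_cases htor : ∀ c : ℤ, gen t k ^ c ∈ upper t (k + 1) → c = 0
      · refine ⟨F, hF, fun g hg hgk => hcov g hg ?_⟩
        obtain ⟨c, u, hu, rfl⟩ := exists_of_mem_upper k hgk
        by_cases hc : c = 0
        · simpa [hc] using hu
        · exact absurd ⟨htor, c, hc, u, hu, hg⟩ hk
      · push Not at htor
        obtain ⟨c, hcU, hc⟩ := htor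
        -- In the torsion case `u = (a_k ^ c)⁻¹` is allowed, and the required element of `N` is `1`.
        exact main c hc _ ((upper t (k + 1)).inv_mem hcU) (by simp)

/-- An infinite factor must add a leading index, since otherwise `exists_cover` would make it
finite. -/
theorem SeriesLength.le_ncard {K : Subgroup (NilGroup t)} {h : ℕ} (hK : SeriesLength K h) :
    h ≤ (leadingIndices t K).ncard := by
  induction hK with
  | bot => exact Nat.zero_le _
  | finite_step N H h hN hle hcyc hfin ih =>
    exact ih.trans (Set.ncard_le_ncard (leadingIndices_mono hle))
  | infinite_step N H h hN hle hcyc hinf ih =>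
    refine Nat.succ_le_of_lt (ih.trans_lt (Set.ncard_lt_ncard ⟨leadingIndices_mono hle, ?_⟩))
    intro hsub
    obtain ⟨F, hF, hcov⟩ := exists_cover hle hsub 0
    have := finite_quotient_of_cover hF fun g hg =>
      hcov g hg (upper_zero (t := t) ▸ Subgroup.mem_top g)
    exact not_finite (H ⧸ N.subgroupOf H)

theorem eq_zero_of_zpow_mem_upper (ht : t ∈ consistentParams n) (i : Fin n) {c : ℤ}
    (hc : gen t i ^ c ∈ upper t (i + 1)) : c = 0 := by
  have h1 : n ≤ (leadingIndices t ⊤).ncard := SeriesLength.le_ncard ht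
  have h2 : leadingIndices t ⊤ = Set.univ := by
    refine Set.eq_of_subset_of_ncard_le (Set.subset_univ _) ?_
    rw [Set.ncard_univ, Nat.card_fin]
    exact h1
  have h3 : i ∈ leadingIndices t ⊤ := h2 ▸ Set.mem_univ i
  exact h3.1 c hc

end Hirsch

/-! ### Uniqueness and additivity of exponents -/

section Exponents

variable {n : ℕ} {t : Triple n → ℤ}

/-- The vector `x` with the entries at positions `≥ i` replaced by `0`. -/
def truncate (i : ℕ) (x : Fin n → ℤ) : Fin n → ℤ := fun k => if (k : ℕ) < i then x k else 0

theorem truncate_of_lt {i : ℕ} {x : Fin n → ℤ} {k : Fin n} (h : (k : ℕ) < i) :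
    truncate i x k = x k := if_pos h

theorem truncate_of_le {i : ℕ} {x : Fin n → ℤ} {k : Fin n} (h : i ≤ k) :
    truncate i x k = 0 := if_neg (not_lt.2 h)

theorem normalWord_add {x y : Fin n → ℤ} (i : ℕ)
    (hx : ∀ k : Fin n, i ≤ k → x k = 0) (hy : ∀ k : Fin n, (k : ℕ) < i → y k = 0) :
    normalWord t (x + y) = normalWord t x * normalWord t y :=
  orderedProd_add _ i hx hy

theorem normalWord_single (k : Fin n) (c : ℤ) : normalWord t (Pi.single k c) = gen t k ^ c :=
  orderedProd_single _ _ _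

theorem normalWord_zero : normalWord t 0 = 1 := orderedProd_zero _

theorem normalWord_truncate_mul (i : ℕ) (x : Fin n → ℤ) :
    normalWord t (truncate i x) * normalWord t (x - truncate i x) = normalWord t x := by
  rw [← normalWord_add i (fun k hk => truncate_of_le hk)
    (fun k hk => by rw [Pi.sub_apply, truncate_of_lt hk, sub_self]), add_sub_cancel]

theorem mk_normalWord_truncate (i : ℕ) (x : Fin n → ℤ) :
    (normalWord t (truncate i x) : NilGroup t ⧸ upper t i) = normalWord t x := by
  refine QuotientGroup.eq.2 ?_
  rw [← normalWord_truncate_mul i x, inv_mul_cancel_left]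
  exact normalWord_mem_upper fun k hk => by rw [Pi.sub_apply, truncate_of_lt hk, sub_self]

theorem mk_normalWord_succ (k : Fin n) (x : Fin n → ℤ) :
    (normalWord t x : NilGroup t ⧸ upper t (k + 1)) =
      normalWord t (truncate k x) * (gen t k : NilGroup t ⧸ upper t (k + 1)) ^ x k := by
  rw [← mk_normalWord_truncate, ← QuotientGroup.mk_zpow, ← QuotientGroup.mk_mul,
    ← normalWord_single, ← normalWord_add k]
  · congr 2
    funext l
    rcases lt_trichotomy l k with h | rfl | h
    · rw [Pi.add_apply, truncate_of_lt h, truncate_of_lt (Nat.lt_succ_of_lt h),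
        Pi.single_eq_of_ne h.ne, add_zero]
    · rw [Pi.add_apply, truncate_of_lt (Nat.lt_succ_self _), truncate_of_le le_rfl,
        Pi.single_eq_same, zero_add]
    · rw [Pi.add_apply, truncate_of_le (Nat.succ_le_of_lt h), truncate_of_le (Fin.lt_def.1 h).le,
        Pi.single_eq_of_ne h.ne', add_zero]
  · exact fun l hl => truncate_of_le hl
  · exact fun l hl => Pi.single_eq_of_ne (by rintro rfl; omega) _

/-- Once the exponents before `k` agree, cancellation puts `a_k` to the power of the difference of
the `k`-th exponents into `upper t (k + 1)`, so this difference is `0`. -/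
theorem normalWord_injective (ht : t ∈ consistentParams n) :
    Function.Injective (normalWord t) := by
  intro x y hxy
  have key : ∀ i : ℕ, truncate i x = truncate i y := by
    intro i
    induction i with
    | zero => funext k; rw [truncate_of_le (Nat.zero_le _), truncate_of_le (Nat.zero_le _)]
    | succ i ih =>
      by_cases hi : i < n
      · obtain ⟨k, rfl⟩ : ∃ k : Fin n, i = k := ⟨⟨i, hi⟩, rfl⟩
        have h1 := mk_normalWord_succ (t := t) k x
        rw [hxy, mk_normalWord_succ, ih] at h1
        have h2 := mul_left_cancel h1
        rw [← QuotientGroup.mk_zpow, ← QuotientGroup.mk_zpow, QuotientGroup.eq, ← zpow_neg,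
          ← zpow_add] at h2
        have h3 := eq_zero_of_zpow_mem_upper ht k h2
        funext l
        rcases lt_trichotomy l k with h | rfl | h
        · have := congrFun ih l
          rw [truncate_of_lt h, truncate_of_lt h] at this
          rw [truncate_of_lt (Nat.lt_succ_of_lt h), truncate_of_lt (Nat.lt_succ_of_lt h), this]
        · rw [truncate_of_lt (Nat.lt_succ_self _), truncate_of_lt (Nat.lt_succ_self _)]
          omega
        · rw [truncate_of_le (Nat.succ_le_of_lt h), truncate_of_le (Nat.succ_le_of_lt h)]
      · funext l
        have := congrFun ih l
        rw [truncate_of_lt (by omega), truncate_of_lt (by omega)] at this ⊢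
        exact this
  funext k
  have := congrFun (key n) k
  rwa [truncate_of_lt k.2, truncate_of_lt k.2] at this

theorem normalWord_bijective (ht : t ∈ consistentParams n) :
    Function.Bijective (normalWord t) :=
  ⟨normalWord_injective ht, normalWord_surjective t⟩

theorem normalWord_exponents (g : NilGroup t) : normalWord t (exponents t g) = g :=
  Function.invFun_eq (normalWord_surjective t g)

theorem exponents_normalWord (ht : t ∈ consistentParams n) (x : Fin n → ℤ) :
    exponents t (normalWord t x) = x :=
  normalWord_injective ht (normalWord_exponents _)

theorem exponents_one (ht : t ∈ consistentParams n) : exponents t 1 = 0 := by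
  rw [← normalWord_zero, exponents_normalWord ht]

theorem exponents_eq_zero (ht : t ∈ consistentParams n) {i : ℕ} {g : NilGroup t}
    (hg : g ∈ upper t i) {k : Fin n} (hk : (k : ℕ) < i) : exponents t g k = 0 := by
  obtain ⟨x, hx, rfl⟩ := exists_normalWord_of_mem_upper hg
  rw [exponents_normalWord ht, hx k hk]

theorem exponents_eq_of_mk_eq (ht : t ∈ consistentParams n) {i : ℕ} {g h : NilGroup t}
    (hgh : (g : NilGroup t ⧸ upper t i) = h) {k : Fin n} (hk : (k : ℕ) < i) :
    exponents t g k = exponents t h k := by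
  obtain ⟨v, hv, hv'⟩ := exists_normalWord_of_mem_upper (t := t) (i := i)
    (g := (normalWord t (truncate i (exponents t g)))⁻¹ * h) (by
      rw [← QuotientGroup.eq, mk_normalWord_truncate, normalWord_exponents, hgh])
  have : h = normalWord t (truncate i (exponents t g) + v) := by
    rw [normalWord_add i (fun l hl => truncate_of_le hl) hv, hv', mul_inv_cancel_left]
  rw [this, exponents_normalWord ht, Pi.add_apply, truncate_of_lt hk, hv k hk, add_zero]

/-- The exponent at `k` is additive in the factor `a_k` modulo `⟨a_{k+1}, ..., a_n⟩`. -/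
theorem exponents_eq_add (ht : t ∈ consistentParams n) (k : Fin n) {g h : NilGroup t} {c : ℤ}
    (hgh : (g : NilGroup t ⧸ upper t (k + 1)) =
      h * (gen t k : NilGroup t ⧸ upper t (k + 1)) ^ c) :
    exponents t g k = exponents t h k + c := by
  set x := exponents t h with hx
  have : (g : NilGroup t ⧸ upper t (k + 1)) =
      normalWord t (truncate k x + Pi.single k (x k + c)) := by
    rw [hgh, ← normalWord_exponents h, ← hx, mk_normalWord_succ, mul_assoc, ← zpow_add,
      normalWord_add k (fun l hl => truncate_of_le hl)
        (fun l hl => Pi.single_eq_of_ne (by rintro rfl; omega) _), normalWord_single]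
    rfl
  rw [exponents_eq_of_mk_eq ht this (Nat.lt_succ_self _), exponents_normalWord ht, Pi.add_apply,
    truncate_of_le le_rfl, Pi.single_eq_same, zero_add]

/-- Modulo `upper t (k + 1)` both powers of the central `a_k` can be moved to the far right. At the
last index this gives the shape `x_n + y_n + H_n`. -/
theorem multFun_eq_add (ht : t ∈ consistentParams n) (x y : Fin n → ℤ) (k : Fin n) :
    multFun t x y k = multFun t (truncate k x) (truncate k y) k + (x k + y k) := by
  refine exponents_eq_add ht k ?_
  rw [QuotientGroup.mk_mul, QuotientGroup.mk_mul, mk_normalWord_succ k x, mk_normalWord_succ k y,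
    zpow_add]
  have h := ((commute_mk_gen (t := t) k (normalWord t (truncate k y))).zpow_right (x k)).eq
  rw [mul_assoc, ← mul_assoc (_ ^ x k), ← h]
  simp only [mul_assoc]

end Exponents

end HallPoly

/-! ### Truncated elements and conjugation -/

namespace HallPoly

variable {n : ℕ}

section Truncation

variable {t : Triple n → ℤ}

/-- The element `a_1 ^ x_1 * ... * a_k ^ x_k` for `g = a_1 ^ x_1 * ... * a_n ^ x_n`. -/
noncomputable def truncElt (t : Triple n → ℤ) (k : ℕ) (g : NilGroup t) : NilGroup t :=
  normalWord t (truncate k (exponents t g))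

theorem truncElt_mem_upper (ht : t ∈ consistentParams n) (k : ℕ) {i : ℕ} {g : NilGroup t}
    (hg : g ∈ upper t i) : truncElt t k g ∈ upper t i := by
  refine normalWord_mem_upper fun l hl => ?_
  by_cases h : (l : ℕ) < k
  · rw [truncate_of_lt h, exponents_eq_zero ht hg hl]
  · exact truncate_of_le (not_lt.1 h)

theorem mk_eq_truncElt_mul (k : Fin n) (g : NilGroup t) :
    (g : NilGroup t ⧸ upper t (k + 1)) =
      truncElt t k g * (gen t k : NilGroup t ⧸ upper t (k + 1)) ^ exponents t g k := by
  conv_lhs => rw [← normalWord_exponents g]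
  exact mk_normalWord_succ k _

theorem exponents_mul (ht : t ∈ consistentParams n) (g h : NilGroup t) (k : Fin n) :
    exponents t (g * h) k = exponents t (truncElt t k g * truncElt t k h) k +
      (exponents t g k + exponents t h k) := by
  have := multFun_eq_add ht (exponents t g) (exponents t h) k
  rwa [multFun, normalWord_exponents, normalWord_exponents] at this

theorem exponents_conj (ht : t ∈ consistentParams n) (a g : NilGroup t) (k : Fin n) :
    exponents t (a⁻¹ * g * a) k = exponents t (a⁻¹ * truncElt t k g * a) k +
      exponents t g k := by
  refine exponents_eq_add ht k ?_
  simp only [QuotientGroup.mk_mul]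
  conv_lhs => rw [mk_eq_truncElt_mul k g]
  have h := ((commute_mk_gen (t := t) k a).zpow_right (exponents t g k)).eq
  rw [mul_assoc, mul_assoc _ (_ ^ _), ← h]
  simp only [mul_assoc]

theorem gen_conj {i j : Fin n} (hij : i < j) :
    (gen t i)⁻¹ * gen t j * gen t i = normalWord t (Pi.single j 1 + tailExp t i j) := by
  rw [mul_assoc, gen_mul_gen t hij, mul_assoc, inv_mul_cancel_left,
    normalWord_add (j + 1) _ fun k hk => tailExp_eq_zero hk, normalWord_single, zpow_one]
  exact fun k hk => Pi.single_eq_of_ne (by rintro rfl; omega) _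

theorem exponents_gen_zpow_mul (ht : t ∈ consistentParams n) (i : Fin n) (c : ℤ)
    {u : NilGroup t} (hu : u ∈ upper t (i + 1)) :
    exponents t (gen t i ^ c * u) = Pi.single i c + exponents t u := by
  conv_lhs => rw [← normalWord_exponents u, ← normalWord_single]
  rw [← normalWord_add (i + 1) _ fun k hk => exponents_eq_zero ht hu hk, exponents_normalWord ht]
  exact fun k hk => Pi.single_eq_of_ne (by rintro rfl; omega) _

theorem conj_zpow_mem {i : Fin n} {g : NilGroup t} {j : ℕ} (hg : g ∈ upper t j) (z : ℤ) :
    (gen t i ^ z)⁻¹ * g * gen t i ^ z ∈ upper t j := by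
  simpa using (upper_normal (t := t) j).conj_mem _ hg (gen t i ^ z)⁻¹

/-- The element `a_{i+1} ^ x_{i+1} * ... * a_n ^ x_n` for `g = a_1 ^ x_1 * ... * a_n ^ x_n`. -/
noncomputable def tailElt (i : Fin n) (g : NilGroup t) : NilGroup t :=
  normalWord t (exponents t g - truncate (i + 1) (exponents t g))

theorem tailElt_mem_upper (i : Fin n) (g : NilGroup t) : tailElt i g ∈ upper t (i + 1) :=
  normalWord_mem_upper fun k hk => by rw [Pi.sub_apply, truncate_of_lt hk, sub_self]

theorem eq_gen_zpow_mul_tailElt (ht : t ∈ consistentParams n) (i : Fin n) {g : NilGroup t}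
    (hg : g ∈ upper t i) : g = gen t i ^ exponents t g i * tailElt i g := by
  have h : truncate (i + 1) (exponents t g) = Pi.single i (exponents t g i) := by
    funext l
    rcases lt_trichotomy l i with h | rfl | h
    · rw [truncate_of_lt (Nat.lt_succ_of_lt h), Pi.single_eq_of_ne h.ne,
        exponents_eq_zero ht hg h]
    · rw [truncate_of_lt (Nat.lt_succ_self _), Pi.single_eq_same]
    · rw [truncate_of_le (Nat.succ_le_of_lt h), Pi.single_eq_of_ne h.ne']
  rw [← normalWord_single, ← h, tailElt, normalWord_truncate_mul, normalWord_exponents]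

end Truncation

/-! ### Polynomiality of multiplication, by descending induction -/

section Families

variable {D : Type}

/-- A family of elements of the groups `G(t d)` whose exponents lie in a given algebra. -/
def ExponentsIn (A : Subalgebra ℚ (D → ℚ)) (t : D → Triple n → ℤ)
    (g : ∀ d, NilGroup (t d)) : Prop :=
  ∀ k, (fun d => (exponents (t d) (g d) k : ℚ)) ∈ A

/-- Multiplication in the subgroups `⟨a_{i+1}, ..., a_n⟩` is given by polynomials: it preserves
families with exponents in an algebra that contains the parameters. -/
def PolynomialMul (n i : ℕ) : Prop :=
  ∀ (D : Type) (A : Subalgebra ℚ (D → ℚ)) (t : D → Triple n → ℤ),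
    (∀ d, t d ∈ consistentParams n) → (∀ a, (fun d => (t d a : ℚ)) ∈ A) →
    ∀ g h : ∀ d, NilGroup (t d), (∀ d, g d ∈ upper (t d) i) → (∀ d, h d ∈ upper (t d) i) →
      ExponentsIn A t g → ExponentsIn A t h → ExponentsIn A t fun d => g d * h d

variable {A : Subalgebra ℚ (D → ℚ)} {t : D → Triple n → ℤ}

theorem exponentsIn_one (ht : ∀ d, t d ∈ consistentParams n) :
    ExponentsIn A t fun _ => 1 := by
  intro k
  simp only [exponents_one (ht _), Pi.zero_apply, Int.cast_zero]
  exact A.zero_mem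

theorem exponentsIn_normalWord (ht : ∀ d, t d ∈ consistentParams n) {x : D → Fin n → ℤ}
    (hx : ∀ k, (fun d => (x d k : ℚ)) ∈ A) :
    ExponentsIn A t fun d => normalWord (t d) (x d) := by
  intro k
  simp only [exponents_normalWord (ht _)]
  exact hx k

theorem exponentsIn_truncElt (ht : ∀ d, t d ∈ consistentParams n) {g : ∀ d, NilGroup (t d)}
    (i : ℕ) (hg : ∀ k : Fin n, (k : ℕ) < i → (fun d => (exponents (t d) (g d) k : ℚ)) ∈ A) :
    ExponentsIn A t fun d => truncElt (t d) i (g d) := by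
  refine exponentsIn_normalWord ht fun k => ?_
  by_cases hk : (k : ℕ) < i
  · simpa only [truncate_of_lt hk] using hg k hk
  · simp only [truncate_of_le (not_lt.1 hk), Int.cast_zero]
    exact A.zero_mem

theorem exponentsIn_tailElt (ht : ∀ d, t d ∈ consistentParams n) {g : ∀ d, NilGroup (t d)}
    (i : Fin n) (hg : ExponentsIn A t g) : ExponentsIn A t fun d => tailElt i (g d) := by
  refine exponentsIn_normalWord ht fun k => ?_
  by_cases hk : (k : ℕ) < i + 1
  · simp only [Pi.sub_apply, truncate_of_lt hk, sub_self, Int.cast_zero]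
    exact A.zero_mem
  · simp only [Pi.sub_apply, truncate_of_le (not_lt.1 hk), sub_zero]
    exact hg k

theorem ExponentsIn.comp_fst {g : ∀ d, NilGroup (t d)} (hg : ExponentsIn A t g) :
    ExponentsIn (polyExt A) (fun p : D × ℤ => t p.1) fun p => g p.1 :=
  fun k => comp_fst_mem_polyExt (hg k)

theorem ExponentsIn.comp_graph {g : ∀ p : D × ℤ, NilGroup (t p.1)}
    (hg : ExponentsIn (polyExt A) (fun p : D × ℤ => t p.1) g) {z : D → ℤ}
    (hz : (fun d => (z d : ℚ)) ∈ A) : ExponentsIn A t fun d => g (d, z d) :=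
  fun k => comp_graph_mem (hg k) hz

/-- From `g ^ (z + 1) = g ^ z * g`, the difference of the `k`-th exponents is that of `g` plus a
contribution of the truncations at `k`. By induction on `k` the latter is polynomial in `z`, and
summation applies. -/
theorem PolynomialMul.zpow {i : ℕ} (hi : PolynomialMul n i) (ht : ∀ d, t d ∈ consistentParams n)
    (hA : ∀ a, (fun d => (t d a : ℚ)) ∈ A) {g : ∀ d, NilGroup (t d)}
    (hg : ∀ d, g d ∈ upper (t d) i) (hgA : ExponentsIn A t g) :
    ExponentsIn (polyExt A) (fun p : D × ℤ => t p.1) fun p => g p.1 ^ p.2 := by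
  intro k
  induction k using WellFoundedLT.induction with
  | ind k ih =>
    refine mem_polyExt_of_sub_mem ?_ ?_
    · simp only [zpow_zero, exponents_one (ht _), Pi.zero_apply, Int.cast_zero]
      exact A.zero_mem
    · have hmul := hi (D × ℤ) (polyExt A) (fun p => t p.1) (fun p => ht p.1)
        (fun a => comp_fst_mem_polyExt (hA a))
        (fun p => truncElt (t p.1) k (g p.1 ^ p.2)) (fun p => truncElt (t p.1) k (g p.1))
        (fun p => truncElt_mem_upper (ht _) _ (Subgroup.zpow_mem _ (hg _) _))
        (fun p => truncElt_mem_upper (ht _) _ (hg _))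
        (exponentsIn_truncElt (t := fun p : D × ℤ => t p.1) (g := fun p => g p.1 ^ p.2)
          (fun p => ht p.1) k fun l hl => ih l hl)
        (exponentsIn_truncElt (t := fun p : D × ℤ => t p.1) (g := fun p => g p.1)
          (fun p => ht p.1) k fun l _ => hgA.comp_fst l) k
      convert! (polyExt A).add_mem hmul (hgA.comp_fst k) using 1
      funext p
      rw [Pi.add_apply]
      beta_reduce
      rw [zpow_add_one, exponents_mul (ht _)]
      push_cast
      ring

theorem PolynomialMul.list_prod {i : ℕ} (hi : PolynomialMul n i)
    (ht : ∀ d, t d ∈ consistentParams n) (hA : ∀ a, (fun d => (t d a : ℚ)) ∈ A) {m : ℕ}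
    {g : ∀ d, Fin m → NilGroup (t d)} (hg : ∀ d j, g d j ∈ upper (t d) i)
    (hgA : ∀ j, ExponentsIn A t fun d => g d j) :
    ExponentsIn A t fun d => (List.ofFn (g d)).prod := by
  induction m with
  | zero => simpa using exponentsIn_one ht
  | succ m ih =>
    simp only [List.ofFn_succ, List.prod_cons]
    refine hi D A t ht hA _ _ (fun d => hg d 0) (fun d => ?_) (hgA 0)
      (ih (fun d j => hg d j.succ) fun j => hgA j.succ)
    refine Subgroup.list_prod_mem _ fun b hb => ?_
    obtain ⟨j, rfl⟩ := (List.mem_ofFn' _ _).1 hb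
    exact hg d j.succ

/-- Conjugation is applied to each factor of the normal form. The conjugate of `a_j` is `a_j` times
its tail, with constants and parameters as exponents; powers and products of these stay in `upper t
(i + 1)`. -/
theorem PolynomialMul.conj (i : Fin n) (hi : PolynomialMul n (i + 1))
    (ht : ∀ d, t d ∈ consistentParams n) (hA : ∀ a, (fun d => (t d a : ℚ)) ∈ A)
    {g : ∀ d, NilGroup (t d)} (hg : ∀ d, g d ∈ upper (t d) (i + 1)) (hgA : ExponentsIn A t g) :
    ExponentsIn A t fun d => (gen (t d) i)⁻¹ * g d * gen (t d) i := by
  have hprod : ∀ d, (gen (t d) i)⁻¹ * g d * gen (t d) i = (List.ofFn fun j =>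
      ((gen (t d) i)⁻¹ * gen (t d) j * gen (t d) i) ^ exponents (t d) (g d) j).prod := by
    intro d
    have := map_orderedProd (MulAut.conj (gen (t d) i)⁻¹).toMonoidHom (gen (t d))
      (exponents (t d) (g d))
    change MulAut.conj (gen (t d) i)⁻¹ (normalWord (t d) (exponents (t d) (g d))) = _ at this
    rw [normalWord_exponents, MulAut.conj_apply, inv_inv] at this
    rw [this, orderedProd]
    simp
  simp only [hprod]
  refine hi.list_prod ht hA (fun d j => ?_) fun j => ?_
  · rcases lt_or_ge i j with hij | hij
    · refine Subgroup.zpow_mem _ ?_ _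
      simpa using (upper_normal (t := t d) (i + 1)).conj_mem _
        (gen_mem_upper (t := t d) (Fin.lt_def.1 hij)) (gen (t d) i)⁻¹
    · rw [exponents_eq_zero (ht d) (hg d) (Nat.lt_succ_of_le hij), zpow_zero]
      exact Subgroup.one_mem _
  · rcases lt_or_ge i j with hij | hij
    · refine (hi.zpow (g := fun d => (gen (t d) i)⁻¹ * gen (t d) j * gen (t d) i) ht hA
        (fun d => ?_) ?_).comp_graph (hgA j)
      · simpa using (upper_normal (t := t d) (i + 1)).conj_mem _
          (gen_mem_upper (t := t d) (Fin.lt_def.1 hij)) (gen (t d) i)⁻¹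
      · simp only [gen_conj hij]
        refine exponentsIn_normalWord ht fun k => ?_
        simp only [Pi.add_apply, Int.cast_add]
        refine A.add_mem (x := fun _ => (((Pi.single j 1 : Fin n → ℤ) k : ℤ) : ℚ))
          (A.algebraMap_mem _) ?_
        by_cases hk : i < j ∧ j < k
        · simp only [tailExp, dif_pos hk]
          exact hA _
        · simp only [tailExp, dif_neg hk, Int.cast_zero]
          exact A.zero_mem
    · simp only [exponents_eq_zero (ht _) (hg _) (Nat.lt_succ_of_le hij), zpow_zero]
      exact exponentsIn_one ht

/-- The same difference argument as for powers: one further conjugation by `a_i` changes the `k`-th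
exponent by an amount that depends only on the truncation at `k`. -/
theorem PolynomialMul.conj_zpow (i : Fin n) (hi : PolynomialMul n (i + 1))
    (ht : ∀ d, t d ∈ consistentParams n) (hA : ∀ a, (fun d => (t d a : ℚ)) ∈ A)
    {g : ∀ d, NilGroup (t d)} (hg : ∀ d, g d ∈ upper (t d) (i + 1)) (hgA : ExponentsIn A t g) :
    ExponentsIn (polyExt A) (fun p : D × ℤ => t p.1) fun p =>
      (gen (t p.1) i ^ p.2)⁻¹ * g p.1 * gen (t p.1) i ^ p.2 := by
  intro k
  induction k using WellFoundedLT.induction with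
  | ind k ih =>
    refine mem_polyExt_of_sub_mem ?_ ?_
    · simpa using hgA k
    · have hconj := hi.conj i (fun p : D × ℤ => ht p.1) (A := polyExt A)
        (fun a => comp_fst_mem_polyExt (hA a))
        (fun p => truncElt_mem_upper (ht _) k (conj_zpow_mem (hg p.1) p.2))
        (exponentsIn_truncElt (t := fun p : D × ℤ => t p.1)
          (g := fun p => (gen (t p.1) i ^ p.2)⁻¹ * g p.1 * gen (t p.1) i ^ p.2)
          (fun p => ht p.1) k fun l hl => ih l hl) k
      convert! hconj using 1
      funext p
      have : (gen (t p.1) i ^ (p.2 + 1))⁻¹ * g p.1 * gen (t p.1) i ^ (p.2 + 1) =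
          (gen (t p.1) i)⁻¹ * ((gen (t p.1) i ^ p.2)⁻¹ * g p.1 * gen (t p.1) i ^ p.2) *
            gen (t p.1) i := by
        rw [zpow_add_one]
        group
      beta_reduce
      rw [this, exponents_conj (ht _)]
      push_cast
      ring

theorem PolynomialMul.of_succ (i : Fin n) (hi : PolynomialMul n (i + 1)) :
    PolynomialMul n i := by
  intro D A t ht hA g h hg hh hgA hhA
  have hu : ∀ d, tailElt i (g d) ∈ upper (t d) (i + 1) := fun d => tailElt_mem_upper _ _
  have hv : ∀ d, tailElt i (h d) ∈ upper (t d) (i + 1) := fun d => tailElt_mem_upper _ _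
  have hw := fun d => Subgroup.mul_mem _
    (conj_zpow_mem (i := i) (hu d) (exponents (t d) (h d) i)) (hv d)
  have hwA := hi D A t ht hA _ _ (fun d => conj_zpow_mem (i := i) (hu d) _) hv
    ((hi.conj_zpow i ht hA hu (exponentsIn_tailElt ht i hgA)).comp_graph (hhA i))
    (exponentsIn_tailElt ht i hhA)
  intro k
  -- Collection: `a^α u * a^β v = a^(α+β) * (a^(-β) u a^β) * v`, where the last two factors lie in
  -- `upper (t d) (i + 1)`.
  have key : ∀ d, g d * h d = gen (t d) i ^ (exponents (t d) (g d) i + exponents (t d) (h d) i) *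
      ((gen (t d) i ^ exponents (t d) (h d) i)⁻¹ * tailElt i (g d) *
        gen (t d) i ^ exponents (t d) (h d) i * tailElt i (h d)) := by
    intro d
    conv_lhs => rw [eq_gen_zpow_mul_tailElt (ht d) i (hg d),
      eq_gen_zpow_mul_tailElt (ht d) i (hh d)]
    rw [zpow_add]
    group
  simp only [key, exponents_gen_zpow_mul (ht _) i _ (hw _), Pi.add_apply, Int.cast_add]
  refine A.add_mem ?_ (hwA k)
  by_cases hk : k = i
  · subst hk
    simp only [Pi.single_eq_same, Int.cast_add]
    exact A.add_mem (hgA k) (hhA k)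
  · simp only [Pi.single_eq_of_ne hk, Int.cast_zero]
    exact A.zero_mem

theorem polynomialMul (n i : ℕ) : PolynomialMul n i := by
  by_cases hi : n ≤ i
  · intro D A t ht hA g h hg hh hgA hhA
    simp only [upper_eq_bot hi, Subgroup.mem_bot] at hg hh
    simpa only [hg, hh, mul_one] using exponentsIn_one ht
  · obtain ⟨d, hd⟩ : ∃ d, n = i + d := ⟨n - i, by omega⟩
    induction d generalizing i with
    | zero => omega
    | succ d ih =>
      obtain ⟨k, rfl⟩ : ∃ k : Fin n, i = k := ⟨⟨i, not_le.1 hi⟩, rfl⟩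
      refine PolynomialMul.of_succ k ?_
      by_cases h : n ≤ k + 1
      · intro D A t ht hA g h' hg hh hgA hhA
        simp only [upper_eq_bot h, Subgroup.mem_bot] at hg hh
        simpa only [hg, hh, mul_one] using exponentsIn_one ht
      · exact ih (k + 1) h (by omega)

end Families

end HallPoly

/-! ### Extraction of the polynomials -/

namespace HallPoly

variable {m : ℕ}

theorem truncate_last (x : Fin (m + 1) → ℤ) :
    truncate ((Fin.last m : Fin (m + 1)) : ℕ) x =
      Fin.snoc (α := fun _ => ℤ) (fun i : Fin m => x i.castSucc) 0 := by
  funext k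
  cases k using Fin.lastCases with
  | last => rw [truncate_of_le le_rfl, Fin.snoc_last]
  | cast k => rw [truncate_of_lt (by simp), Fin.snoc_castSucc]

theorem aeval_pi_apply {σ D : Type*} (v : σ → D → ℚ) (p : MvPolynomial σ ℚ) (d : D) :
    MvPolynomial.aeval v p d = MvPolynomial.eval (fun a => v a d) p := by
  change Pi.evalAlgHom ℚ (fun _ : D => ℚ) d (MvPolynomial.aeval v p) = _
  rw [← AlgHom.comp_apply, MvPolynomial.comp_aeval, MvPolynomial.aeval_eq_eval]
  rfl

theorem exists_multFun_polynomial (m : ℕ) :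
    ∃ H : MvPolynomial (Triple (m + 1) ⊕ (Fin m ⊕ Fin m)) ℚ,
      ∀ t ∈ consistentParams (m + 1), ∀ x y : Fin (m + 1) → ℤ,
        (multFun t x y (Fin.last m) : ℚ) =
          (x (Fin.last m) : ℚ) + (y (Fin.last m) : ℚ) +
            MvPolynomial.eval
              (Sum.elim (fun a => (t a : ℚ))
                (Sum.elim (fun i : Fin m => (x i.castSucc : ℚ))
                  (fun i : Fin m => (y i.castSucc : ℚ)))) H := by
  -- The last coordinates are left out and later filled with `0`, so `H` cannot involve `x_n` or
  -- `y_n`.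
  let D := consistentParams (m + 1) × (Fin m → ℤ) × (Fin m → ℤ)
  let v : Triple (m + 1) ⊕ (Fin m ⊕ Fin m) → D → ℚ :=
    Sum.elim (fun a d => (d.1.1 a : ℚ))
      (Sum.elim (fun i d => (d.2.1 i : ℚ)) (fun i d => (d.2.2 i : ℚ)))
  let A := (MvPolynomial.aeval (R := ℚ) v).range
  have hv : ∀ a, v a ∈ A := fun a => ⟨MvPolynomial.X a, MvPolynomial.aeval_X _ _⟩
  have hsnoc : ∀ f : D → Fin m → ℤ, (∀ i, (fun d => (f d i : ℚ)) ∈ A) →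
      ∀ k, (fun d => ((Fin.snoc (α := fun _ => ℤ) (f d) 0 : Fin (m + 1) → ℤ) k : ℚ)) ∈ A := by
    intro f hf k
    cases k using Fin.lastCases with
    | last =>
      simp only [Fin.snoc_last, Int.cast_zero]
      exact A.zero_mem
    | cast k => simpa only [Fin.snoc_castSucc] using hf k
  obtain ⟨H, hH⟩ := polynomialMul (m + 1) 0 D A (fun d => d.1.1) (fun d => d.1.2)
    (fun a => hv (Sum.inl a))
    (fun d => normalWord _ (Fin.snoc (α := fun _ => ℤ) d.2.1 0))
    (fun d => normalWord _ (Fin.snoc (α := fun _ => ℤ) d.2.2 0))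
    (fun d => by simp [upper_zero]) (fun d => by simp [upper_zero])
    (exponentsIn_normalWord (fun d => d.1.2)
      (hsnoc (fun d => d.2.1) fun i => hv (Sum.inr (Sum.inl i))))
    (exponentsIn_normalWord (fun d => d.1.2)
      (hsnoc (fun d => d.2.2) fun i => hv (Sum.inr (Sum.inr i)))) (Fin.last m)
  refine ⟨H, fun t ht x y => ?_⟩
  have h := congrFun hH (⟨t, ht⟩, fun i => x i.castSucc, fun i => y i.castSucc)
  rw [multFun_eq_add ht, truncate_last, truncate_last, multFun]
  push_cast
  beta_reduce at h
  rw [← h, add_comm]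
  congr 1
  refine (aeval_pi_apply v H _).trans (congrArg (fun w => MvPolynomial.eval w H) ?_)
  funext a
  rcases a with a | a | a <;> rfl

theorem exists_powFun_polynomial (m : ℕ) :
    ∃ h : (ParamRing (m + 1))[X],
      ∀ t ∈ consistentParams (m + 1), ∀ (x : Fin (m + 1) → ℤ) (z : ℤ),
        (powFun t x (z + 1) (Fin.last m) : ℚ) =
          (powFun t x z (Fin.last m) : ℚ) + evalAt t x z h := by
  let D := consistentParams (m + 1) × (Fin (m + 1) → ℤ)
  let v : Triple (m + 1) ⊕ Fin (m + 1) → D → ℚ :=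
    Sum.elim (fun a d => (d.1.1 a : ℚ)) (fun i d => (d.2 i : ℚ))
  let φ := MvPolynomial.aeval (R := ℚ) v
  have hv : ∀ a, v a ∈ φ.range := fun a => ⟨MvPolynomial.X a, MvPolynomial.aeval_X _ _⟩
  have hpow := (polynomialMul (m + 1) 0).zpow (A := φ.range) (t := fun d : D => d.1.1)
    (g := fun d => normalWord _ d.2) (fun d => d.1.2) (fun a => hv (Sum.inl a))
    (fun d => by simp [upper_zero])
    (exponentsIn_normalWord (fun d => d.1.2) fun i => hv (Sum.inr i)) (Fin.last m)
  obtain ⟨p, hp⟩ := hpow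
  -- The coefficients are functions on `D`; they are lifted to genuine polynomials in `T` and `x`.
  obtain ⟨q, rfl⟩ := Polynomial.map_surjective φ.rangeRestrict.toRingHom
    φ.rangeRestrict_surjective p
  -- Here `q` already represents `K_n`, so its forward difference serves as `h`.
  refine ⟨q.comp (X + 1) - q, fun t ht x z => ?_⟩
  have key : ∀ z : ℤ, (powFun t x z (Fin.last m) : ℚ) = evalAt t x z q := by
    intro z
    refine (hp (⟨t, ht⟩, x) z).trans ?_
    have h1 : (q.map φ.rangeRestrict.toRingHom).eval (z : φ.range) =
        φ.rangeRestrict (q.eval (z : ParamRing (m + 1))) := by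
      rw [Polynomial.eval_map, ← map_intCast φ.rangeRestrict.toRingHom z]
      exact Polynomial.eval₂_hom _ _
    rw [h1]
    refine (aeval_pi_apply v _ _).trans (congrArg (fun w => MvPolynomial.eval w _) ?_)
    funext a
    rcases a with a | a <;> rfl
  rw [key, key]
  simp [evalAt, eval_comp]

end HallPoly

theorem mainTheorem7 (m : ℕ) :
    -- throughout, n = m + 1, and the last index n is `Fin.last m`
    (∀ t : HallPoly.Triple (m + 1) → ℤ,
      HallPoly.gen t (Fin.last m) ∈ Subgroup.center (HallPoly.NilGroup t)) ∧
    (∀ t ∈ HallPoly.consistentParams (m + 1), Function.Bijective (HallPoly.normalWord t)) ∧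
    (∃ H : MvPolynomial (HallPoly.Triple (m + 1) ⊕ (Fin m ⊕ Fin m)) ℚ,
      ∀ t ∈ HallPoly.consistentParams (m + 1), ∀ x y : Fin (m + 1) → ℤ,
        (HallPoly.multFun t x y (Fin.last m) : ℚ) =
          (x (Fin.last m) : ℚ) + (y (Fin.last m) : ℚ) +
            MvPolynomial.eval
              (Sum.elim (fun a => (t a : ℚ))
                (Sum.elim (fun i : Fin m => (x i.castSucc : ℚ))
                  (fun i : Fin m => (y i.castSucc : ℚ)))) H) ∧
    (∃ h : Polynomial (HallPoly.ParamRing (m + 1)),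
      (∀ t ∈ HallPoly.consistentParams (m + 1), ∀ (x : Fin (m + 1) → ℤ) (z : ℤ),
        (HallPoly.powFun t x (z + 1) (Fin.last m) : ℚ) =
          (HallPoly.powFun t x z (Fin.last m) : ℚ) + HallPoly.evalAt t x z h) ∧
      (HallPoly.bernoulliSolution h 0).eval 0 = 0 ∧
      (HallPoly.bernoulliSolution h 0).comp (Polynomial.X + 1) =
        HallPoly.bernoulliSolution h 0 + h ∧
      (∀ t ∈ HallPoly.consistentParams (m + 1), ∀ (x : Fin (m + 1) → ℤ) (z : ℤ),
        (HallPoly.powFun t x z (Fin.last m) : ℚ) =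
          HallPoly.evalAt t x z (HallPoly.bernoulliSolution h 0))) := by
  obtain ⟨h, hh⟩ := HallPoly.exists_powFun_polynomial m
  refine ⟨HallPoly.gen_last_mem_center, fun t ht => HallPoly.normalWord_bijective ht,
    HallPoly.exists_multFun_polynomial m, h, hh, HallPoly.bernoulliSolution_eval_zero h 0,
    HallPoly.bernoulliSolution_comp h 0, fun t ht x => ?_⟩
  refine HallPoly.eq_of_forall_add_one (d := fun z => HallPoly.evalAt t x z h) ?_ (hh t ht x) ?_
  · rw [HallPoly.powFun, zpow_zero, HallPoly.exponents_one ht, HallPoly.evalAt, Int.cast_zero,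
      HallPoly.bernoulliSolution_eval_zero, map_zero, Pi.zero_apply, Int.cast_zero]
  · intro z
    simp only [HallPoly.evalAt, Int.cast_add, Int.cast_one,
      HallPoly.bernoulliSolution_eval_add_one, map_add]
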